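/- Let $q$ be a prime power and let $S=(s_1,\dots,s_r)$ denote a sequence of length $r$ over the finite field $\mathbb{F}_q$. The number wall of $S$ is the triangular array with entry $W_{i,j}(S)=\det(s_{a-b+j})_{0\le a,b\le i}$ in row $i\ge 0$ and column $j$, defined whenever $1\le j-i$ and $j+i\le r$, with an additional row $i=-1$ consisting of ones in the columns $0\le j\le r+1$. Write $\Box(l,n,m)$ for the $l\times l$ square of locations with top left corner in row $m$ and column $n$, that is, rows $m,\dots,m+l-1$ and columns $n,\dots,n+l-1$; its inner frame is the ring of locations (corners included) directly surrounding it. A square $\Box(l',n',m')$ contains $\Box(l,n,m)$ if $n'\le n$, $n+l\le n'+l'$, $m'\le m$ and $m+l\le m'+l'$. A window (open, closed or complete) of the number wall of $S$ is a square $\Box'=\Box(l',n',m')$ with $l'\ge 1$, $m'\ge 0$ whose top row lies in the number wall (i.e. $n'-m'\ge 1$ and $n'+m'+l'-1\le r$), such that every entry of the number wall located in $\Box'$ is zero and every entry of the number wall located on the inner frame of $\Box'$ is nonzero; the lower part of $\Box'$ may overhang the triangle. Let $l\ge 1$, $m\ge 0$, $n$ and $r$ be integers with $r\ge 2m+1+l$,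 and let $\Box=\Box(l,n,m)$ be a square portion whose top row lies in the number wall of sequences of length $r$, i.e. $n-m\ge 1$ and $n+m+l-1\le r$. Then the number of sequences of length $r$ over $\mathbb{F}_q$ whose number wall has a window containing $\Box$ is exactly $q^{r-l}$. -/

import Mathlib

/-- The `(m+1) × (m+1)` Toeplitz matrix `T_S(n, m) = (s_{i-j+n})_{0 ≤ i, j ≤ m}` of a doubly
infinite sequence. -/
def toeplitzMatrix {F : Type*} (S : ℤ → F) (n : ℤ) (m : ℕ) :
    Matrix (Fin (m + 1)) (Fin (m + 1)) F :=
  Matrix.of fun i j => S ((i : ℤ) - (j : ℤ) + n)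

/-- The number wall `W_{m,n}(S)` (row `m`, column `n`) of a doubly infinite sequence. -/
def numberWall {F : Type*} [Field F] (S : ℤ → F) (m n : ℤ) : F :=
  if 0 ≤ m then (toeplitzMatrix S n m.toNat).det
  else if m = -1 then 1
  else 0

/-- A finite sequence `s_1, …, s_r`, continued by zero to a doubly infinite sequence. The continuation
only serves to make the entries total: entries of the number wall that depend on it are never used,
see `InFiniteWall`. -/
def extendSeq {F : Type*} [Field F] {r : ℕ} (s : Fin r → F) (i : ℤ) : F :=
  if h : 1 ≤ i ∧ i ≤ (r : ℤ) then s ⟨(i - 1).toNat, by omega⟩ else 0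

/-- The entry in row `m` and column `n` belongs to the (triangular) number wall generated by a
sequence `s_1, …, s_r`. For `m ≥ 0` this says that the entries `s_{n-m}, …, s_{n+m}` of the matrix
`T_S(n, m)` all have an index in `1, …, r`. -/
def InFiniteWall (r : ℕ) (m n : ℤ) : Prop :=
  1 ≤ n - m ∧ n + m ≤ (r : ℤ)

/-- The square portion `□(l, n, m)`: side length `l`, top left corner in column `n` and row `m`. -/
structure SquarePortion where
  size : ℕ
  col : ℤ
  row : ℤ

namespace SquarePortion

/-- The location in row `i` and column `j` lies in the square. -/
def Mem (B : SquarePortion) (i j : ℤ) : Prop :=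
  B.row ≤ i ∧ i < B.row + B.size ∧ B.col ≤ j ∧ j < B.col + B.size

/-- The location in row `i` and column `j` lies on the inner frame of the square, that is, on the
ring of locations (corners included) directly around it. -/
def InnerFrame (B : SquarePortion) (i j : ℤ) : Prop :=
  (B.row - 1 ≤ i ∧ i ≤ B.row + B.size ∧ B.col - 1 ≤ j ∧ j ≤ B.col + B.size) ∧ ¬ B.Mem i j

/-- `B₁` contains `B₂`. -/
def Contains (B₁ B₂ : SquarePortion) : Prop :=
  B₁.col ≤ B₂.col ∧ B₂.col + B₂.size ≤ B₁.col + B₁.size ∧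
    B₁.row ≤ B₂.row ∧ B₂.row + B₂.size ≤ B₁.row + B₁.size

/-- The square lies in row `0` or below and its top row lies in the number wall of a sequence of
length `r`. Equivalently, its hat generator `s_{n-m}, …, s_{n+m+l-1}` is part of `s_1, …, s_r`.
The lower part of the square may overhang the triangular wall. -/
def TopRowInWall (r : ℕ) (B : SquarePortion) : Prop :=
  0 ≤ B.row ∧ ∀ j : ℤ, B.col ≤ j → j < B.col + B.size → InFiniteWall r B.row j

end SquarePortion

/-- `B` is a window (open, closed or complete) of the number wall of the finite sequence `s`: it has
positive side length, its top row lies in the wall, every entry of the wall in `B` is zero, and every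
entry of the wall on the inner frame of `B` is nonzero. -/
def IsWindow {F : Type*} [Field F] {r : ℕ} (s : Fin r → F) (B : SquarePortion) : Prop :=
  1 ≤ B.size ∧ B.TopRowInWall r ∧
    (∀ i j : ℤ, InFiniteWall r i j → B.Mem i j → numberWall (extendSeq s) i j = 0) ∧
    (∀ i j : ℤ, InFiniteWall r i j → B.InnerFrame i j → numberWall (extendSeq s) i j ≠ 0)

section NumberWallWindows

open Polynomial

variable {F : Type*} [Field F]

/-! Put `a = n - m` and `b = n + m + l - 1`, so that `s_a, …, s_b` are the terms used by the top row
of the square. A window contains the square iff this section has a nonzero annihilating polynomial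
of formal degree `m`, that is, tested on every block of `m + 1` consecutive terms.

Indeed an entry in row `i` is a Toeplitz determinant, which vanishes iff its section of length `2i +
1` has a nonzero annihilator of formal degree `i`. A minimal recurrence of degree `d` with nonzero
outer coefficients, extended as far as it holds, cuts out a window with top row `d`
(`exists_isWindow_of_annihilators_ne_bot`). Conversely, the zeros in the top row of a window, lying
below nonzero entries, all come from one polynomial (`annihilators_ne_bot_of_isWindow`).

For the count let `A_k(s)` be the space of annihilators of degree less than `k`. If `A_{m+1}(s) ≠ 0`
then `|A_{m+1}(s)| = q |A_m(s)|`; otherwise both spaces are trivial. So `|A_{m+1}| - q |A_m|`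
detects the wanted sequences, and the sums of `|A_k(s)|` over `s` follow by double counting, since a
nonzero polynomial imposes independent conditions on `s`. -/

/-! ### Polynomials acting by shifts, and annihilators of sections -/

/-- The left shift on doubly infinite sequences. -/
noncomputable def seqShift (F : Type*) [Field F] : Module.End F (ℤ → F) :=
  LinearMap.funLeft F F (fun t => t + 1)

/-- The action of polynomials on doubly infinite sequences, the variable acting as the left shift. -/
noncomputable def shiftAct (g : F[X]) (s : ℤ → F) : ℤ → F :=
  aeval (seqShift F) g s

theorem seqShift_pow_apply (p : ℕ) (s : ℤ → F) (t : ℤ) : (seqShift F ^ p) s t = s (t + p) := by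
  induction p generalizing t with
  | zero => simp
  | succ p ih =>
    rw [pow_succ', Module.End.mul_apply]
    simp only [seqShift, LinearMap.funLeft_apply]
    rw [← seqShift, ih]
    congr 1
    push_cast
    ring

theorem shiftAct_apply {g : F[X]} {k : ℕ} (hg : g.degree < k) (s : ℤ → F) (t : ℤ) :
    shiftAct g s t = ∑ p ∈ Finset.range k, g.coeff p * s (t + p) := by
  by_cases h0 : g = 0
  · simp [h0, shiftAct]
  · have hn : g.natDegree < k := (natDegree_lt_iff_degree_lt h0).2 hg
    simp [shiftAct, aeval_eq_sum_range' hn, seqShift_pow_apply]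

theorem shiftAct_mul (g h : F[X]) (s : ℤ → F) :
    shiftAct (g * h) s = shiftAct g (shiftAct h s) := by
  simp [shiftAct]

theorem shiftAct_comm (g h : F[X]) (s : ℤ → F) :
    shiftAct g (shiftAct h s) = shiftAct h (shiftAct g s) := by
  rw [← shiftAct_mul, ← shiftAct_mul, mul_comm]

theorem shiftAct_X_pow_mul (u : ℕ) (g : F[X]) (s : ℤ → F) (t : ℤ) :
    shiftAct (X ^ u * g) s t = shiftAct g s (t + u) := by
  rw [shiftAct_mul]
  simp only [shiftAct, map_pow, aeval_X]
  rw [seqShift_pow_apply]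

/-- The polynomials of degree less than `k` that annihilate the section `s_a, …, s_b`, that is, the
linear recurrences of order less than `k` satisfied by this section. -/
def annihilators (s : ℤ → F) (a b : ℤ) (k : ℕ) : Submodule F F[X] where
  -- The range of `t` depends on `k` and not on the degree of `g`. This gives a subspace, and `X ^ u
  -- * g` can ignore the first `u` terms while spare degree ignores terms at the end.
  carrier := {g | g.degree < k ∧ ∀ t : ℤ, a ≤ t → t + k ≤ b + 1 → shiftAct g s t = 0}
  add_mem' := by
    rintro g h ⟨hg, hg'⟩ ⟨hh, hh'⟩
    refine ⟨lt_of_le_of_lt (degree_add_le _ _) (max_lt hg hh), fun t h1 h2 => ?_⟩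
    have e1 := hg' t h1 h2
    have e2 := hh' t h1 h2
    simp only [shiftAct] at e1 e2 ⊢
    simp [e1, e2]
  zero_mem' := by simp [shiftAct]
  smul_mem' := by
    rintro x g ⟨hg, hg'⟩
    refine ⟨lt_of_le_of_lt (degree_smul_le _ _) hg, fun t h1 h2 => ?_⟩
    have e1 := hg' t h1 h2
    simp only [shiftAct] at e1 ⊢
    simp [e1]

theorem mem_annihilators {s : ℤ → F} {a b : ℤ} {k : ℕ} {g : F[X]} :
    g ∈ annihilators s a b k ↔
      g.degree < k ∧ ∀ t : ℤ, a ≤ t → t + k ≤ b + 1 → shiftAct g s t = 0 := Iff.rfl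

theorem annihilators_mono {s : ℤ → F} {a b a' b' : ℤ} {k : ℕ} (ha : a ≤ a') (hb : b' ≤ b) :
    annihilators s a b k ≤ annihilators s a' b' k :=
  fun _ hg => ⟨hg.1, fun t h1 h2 => hg.2 t (by omega) (by omega)⟩

theorem annihilators_zero (s : ℤ → F) (a b : ℤ) : annihilators s a b 0 = ⊥ := by
  refine (Submodule.eq_bot_iff _).2 fun g hg => ?_
  have := hg.1
  simpa using this

theorem degree_X_pow_mul_lt {u k K : ℕ} {g : F[X]} (hg : g.degree < k) (h : u + k ≤ K) :
    (X ^ u * g : F[X]).degree < (K : WithBot ℕ) := by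
  by_cases h0 : g = 0
  · simp only [h0, mul_zero, degree_zero]
    exact WithBot.bot_lt_coe _
  · rw [← natDegree_lt_iff_degree_lt h0] at hg
    rw [← natDegree_lt_iff_degree_lt (by simp [h0]), natDegree_X_pow_mul _ h0]
    omega

theorem X_pow_mul_mem_annihilators {s : ℤ → F} {a b a' b' : ℤ} {k K u : ℕ} {g : F[X]}
    (hg : g ∈ annihilators s a b k) (hK : u + k ≤ K) (ha : a ≤ a' + u)
    (hb : b' + u + k ≤ b + K) : X ^ u * g ∈ annihilators s a' b' K := by
  refine ⟨degree_X_pow_mul_lt hg.1 hK, fun t h1 h2 => ?_⟩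
  rw [shiftAct_X_pow_mul]
  exact hg.2 _ (by omega) (by omega)

theorem X_pow_mul_mem_annihilators_iff {s : ℤ → F} {a b : ℤ} {k u : ℕ} {g : F[X]} :
    X ^ u * g ∈ annihilators s a b (u + k) ↔ g ∈ annihilators s (a + u) b k := by
  constructor
  · rintro ⟨h1, h2⟩
    refine ⟨?_, fun t ht1 ht2 => ?_⟩
    · by_cases h0 : g = 0
      · simp only [h0, degree_zero]
        exact WithBot.bot_lt_coe _
      · rw [← natDegree_lt_iff_degree_lt (by simp [h0]), natDegree_X_pow_mul _ h0] at h1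
        rw [← natDegree_lt_iff_degree_lt h0]
        omega
    · have := h2 (t - u) (by omega) (by push_cast; omega)
      rw [shiftAct_X_pow_mul] at this
      simpa using this
  · intro h
    exact X_pow_mul_mem_annihilators h le_rfl (by omega) (by push_cast; omega)

/-- Left kernel vectors of the Toeplitz matrix are the coefficient vectors of annihilators: each
column tests one position `t = j - q`. -/
theorem numberWall_eq_zero_iff (S : ℤ → F) (i : ℕ) (j : ℤ) :
    numberWall S i j = 0 ↔ annihilators S (j - i) (j + i) (i + 1) ≠ ⊥ := by
  have h1 : numberWall S i j = (toeplitzMatrix S j i).det := by simp [numberWall]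
  rw [h1, ← Matrix.exists_vecMul_eq_zero_iff, Submodule.ne_bot_iff]
  have key : ∀ g : F[X], g.degree < (i + 1 : ℕ) → ∀ q : Fin (i + 1),
      Matrix.vecMul (fun p : Fin (i + 1) => g.coeff p) (toeplitzMatrix S j i) q
        = shiftAct g S (j - q) := by
    intro g hg q
    rw [shiftAct_apply hg, Finset.sum_range]
    simp only [Matrix.vecMul, dotProduct, toeplitzMatrix, Matrix.of_apply]
    refine Finset.sum_congr rfl fun p _ => ?_
    congr 2
    ring
  constructor
  · rintro ⟨v, hv, hv0⟩
    set g : F[X] := ((degreeLTEquiv F (i + 1)).symm v).1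
    have hg : g.degree < (i + 1 : ℕ) :=
      mem_degreeLT.1 ((degreeLTEquiv F (i + 1)).symm v).2
    have hgv : (fun p : Fin (i + 1) => g.coeff p) = v := by
      have : degreeLTEquiv F (i + 1) ((degreeLTEquiv F (i + 1)).symm v) = v := by simp
      exact this
    refine ⟨g, ⟨hg, fun t ht1 ht2 => ?_⟩, ?_⟩
    · have := key g hg ⟨(j - t).toNat, by push_cast at ht2; omega⟩
      rw [hgv, hv0] at this
      rw [show t = j - ((j - t).toNat : ℤ) by push_cast at ht2; omega]
      exact this.symm
    · intro h0
      apply hv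
      rw [← hgv, h0]
      ext
      simp
  · rintro ⟨g, ⟨hg, hg'⟩, h0⟩
    refine ⟨fun p => g.coeff p, fun h => h0 ?_, ?_⟩
    · ext p
      by_cases hp : p < i + 1
      · simpa using congrFun h ⟨p, hp⟩
      · rw [coeff_zero]
        exact coeff_eq_zero_of_degree_lt (lt_of_lt_of_le hg (by exact_mod_cast not_lt.1 hp))
    · ext q
      rw [key g hg]
      exact hg' _ (by omega) (by push_cast; omega)

/-! ### Minimal recurrences and the structure of annihilators -/

/-- `c` is a linear recurrence for the section `s_a, …, s_b` with nonzero constant and leading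
coefficient, and there is no shorter recurrence. -/
structure IsMinimalRecurrence (s : ℤ → F) (a b : ℤ) (c : F[X]) : Prop where
  coeff_zero_ne : c.coeff 0 ≠ 0
  shiftAct_eq_zero : ∀ t : ℤ, a ≤ t → t + c.natDegree ≤ b → shiftAct c s t = 0
  annihilators_eq_bot : annihilators s a b c.natDegree = ⊥

/-- A block of zeros as long as the order propagates forward through the leading coefficient and
backward through the constant one. -/
theorem eq_zero_of_shiftAct_eq_zero {c : F[X]} (hc : c.coeff 0 ≠ 0) {h : ℤ → F} {a b a₁ : ℤ}
    (hrec : ∀ t : ℤ, a ≤ t → t + c.natDegree ≤ b → shiftAct c h t = 0)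
    (ha₁ : a ≤ a₁) (hb₁ : a₁ + c.natDegree ≤ b + 1)
    (h0 : ∀ t : ℤ, a₁ ≤ t → t < a₁ + c.natDegree → h t = 0) :
    ∀ t : ℤ, a ≤ t → t ≤ b → h t = 0 := by
  have hc0 : c ≠ 0 := fun h => hc (by simp [h])
  have hdeg : c.degree < (c.natDegree + 1 : ℕ) :=
    (natDegree_lt_iff_degree_lt hc0).1 (Nat.lt_succ_self _)
  have hlead : c.coeff c.natDegree ≠ 0 := by
    simpa using hc0
  have forward : ∀ x : ℕ, a₁ + x ≤ b → h (a₁ + x) = 0 := by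
    intro x
    induction x using Nat.strong_induction_on with
    | _ x ih =>
      intro hx
      by_cases hxe : (x : ℤ) < c.natDegree
      · exact h0 _ (by omega) (by omega)
      · have h1 := hrec (a₁ + x - c.natDegree) (by omega) (by omega)
        rw [shiftAct_apply hdeg, Finset.sum_range_succ, Finset.sum_eq_zero, zero_add] at h1
        · rw [sub_add_cancel] at h1
          exact (mul_eq_zero.1 h1).resolve_left hlead
        · intro p hp
          rw [Finset.mem_range] at hp
          have := ih (x - c.natDegree + p) (by omega) (by omega)
          rw [show a₁ + (x : ℤ) - c.natDegree + p = a₁ + ((x - c.natDegree + p : ℕ) : ℤ) by omega,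
            this, mul_zero]
  have backward : ∀ x : ℕ, a ≤ a₁ - x → ∀ t, a₁ - x ≤ t → t ≤ b → h t = 0 := by
    intro x
    induction x with
    | zero =>
      intro _ t h1 h2
      have := forward (t - a₁).toNat (by omega)
      rwa [show a₁ + ((t - a₁).toNat : ℤ) = t by omega] at this
    | succ x ih =>
      intro hx t h1 h2
      by_cases ht : a₁ - x ≤ t
      · exact ih (by omega) t ht h2
      · have h3 := hrec t (by omega) (by omega)
        rw [shiftAct_apply hdeg, Finset.sum_range_succ', Finset.sum_eq_zero, zero_add] at h3
        · simp only [Nat.cast_zero, add_zero] at h3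
          exact (mul_eq_zero.1 h3).resolve_left hc
        · intro p hp
          rw [Finset.mem_range] at hp
          rw [ih (by omega) (t + ((p + 1 : ℕ) : ℤ)) (by omega) (by omega), mul_zero]
  intro t h1 h2
  by_cases ht : a₁ ≤ t
  · have := forward (t - a₁).toNat (by omega)
    rwa [show a₁ + ((t - a₁).toNat : ℤ) = t by omega] at this
  · exact backward (a₁ - t).toNat (by omega) t (by omega) h2

/-- If `g` annihilates the subsection, the sequence `g · s` still obeys `c` and has `c.natDegree`
consecutive zeros there, so `g` annihilates the whole section. -/
theorem IsMinimalRecurrence.annihilators_subsection_eq_bot {s : ℤ → F} {a b a₁ b₁ : ℤ} {c : F[X]}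
    (hc : IsMinimalRecurrence s a b c) (ha : a ≤ a₁) (hb : b₁ ≤ b)
    (hlen : a₁ + 2 * c.natDegree ≤ b₁ + 2) : annihilators s a₁ b₁ c.natDegree = ⊥ := by
  refine (Submodule.eq_bot_iff _).2 fun g hg => ?_
  have hmem : g ∈ annihilators s a b c.natDegree := by
    refine ⟨hg.1, fun t h1 h2 => ?_⟩
    refine eq_zero_of_shiftAct_eq_zero hc.coeff_zero_ne (a := a) (b := b + 1 - c.natDegree)
      (a₁ := a₁) (fun t h1 h2 => ?_) ha (by omega) (fun t h1 h2 => hg.2 t h1 (by omega)) t h1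
      (by omega)
    rw [shiftAct_comm, shiftAct_apply hg.1]
    refine Finset.sum_eq_zero fun p hp => ?_
    rw [Finset.mem_range] at hp
    rw [hc.shiftAct_eq_zero _ (by omega) (by omega), mul_zero]
  rwa [hc.annihilators_eq_bot, Submodule.mem_bot] at hmem

theorem IsMinimalRecurrence.subsection {s : ℤ → F} {a b a₁ b₁ : ℤ} {c : F[X]}
    (hc : IsMinimalRecurrence s a b c) (ha : a ≤ a₁) (hb : b₁ ≤ b)
    (hlen : a₁ + 2 * c.natDegree ≤ b₁ + 2) : IsMinimalRecurrence s a₁ b₁ c :=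
  ⟨hc.coeff_zero_ne, fun t h1 h2 => hc.shiftAct_eq_zero t (by omega) (by omega),
    hc.annihilators_subsection_eq_bot ha hb hlen⟩

/-- As `g` annihilates `s`, it also annihilates `c · s`, which is zero on the section but nonzero
just outside. Sliding `g` over either end isolates one outer coefficient at a time. -/
theorem coeff_eq_zero_of_mem_annihilators {s : ℤ → F} {a b : ℤ} {c g : F[X]} {u v k : ℕ}
    (hc : ∀ t : ℤ, a ≤ t → t + c.natDegree ≤ b → shiftAct c s t = 0)
    (hu : 0 < u → shiftAct c s (a - 1) ≠ 0)
    (hv : 0 < v → shiftAct c s (b + 1 - c.natDegree) ≠ 0)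
    (hk : a + k + c.natDegree ≤ b + 2)
    (hg : g ∈ annihilators s (a - u) (b + v) k) :
    (∀ p, p < u → g.coeff p = 0) ∧ ∀ p, p < v → g.coeff (k - 1 - p) = 0 := by
  have hgk : ∀ p, k ≤ p → g.coeff p = 0 := fun p hp =>
    coeff_eq_zero_of_degree_lt (lt_of_lt_of_le hg.1 (by exact_mod_cast hp))
  have hrow : ∀ t : ℤ, a - u ≤ t → t + c.natDegree + k ≤ b + v + 1 →
      ∑ p ∈ Finset.range k, g.coeff p * shiftAct c s (t + p) = 0 := by
    intro t h1 h2
    rw [← shiftAct_apply hg.1, shiftAct_comm]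
    by_cases hc0 : c = 0
    · simp [hc0, shiftAct]
    rw [shiftAct_apply ((natDegree_lt_iff_degree_lt hc0).1 (Nat.lt_succ_self _))]
    refine Finset.sum_eq_zero fun p hp => ?_
    rw [Finset.mem_range] at hp
    rw [hg.2 _ (by omega) (by omega), mul_zero]
  constructor
  · intro p
    induction p using Nat.strong_induction_on with
    | _ p ih =>
      intro hp
      by_cases hpk : k ≤ p
      · exact hgk p hpk
      have h1 := hrow (a - 1 - p) (by omega) (by omega)
      rw [Finset.sum_eq_single_of_mem p (Finset.mem_range.2 (by omega))] at h1
      · rw [sub_add_cancel] at h1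
        exact (mul_eq_zero.1 h1).resolve_right (hu (by omega))
      · intro x hx hxp
        rw [Finset.mem_range] at hx
        rcases lt_or_gt_of_ne hxp with h | h
        · rw [ih x h (by omega), zero_mul]
        · rw [hc _ (by omega) (by omega), mul_zero]
  · intro p
    induction p using Nat.strong_induction_on with
    | _ p ih =>
      intro hp
      rcases Nat.eq_zero_or_pos k with hk0 | hk0
      · exact hgk _ (by omega)
      rcases Nat.lt_or_ge p k with hpk | hpk
      swap
      · have := ih (k - 1) (by omega) (by omega)
        rwa [show k - 1 - p = k - 1 - (k - 1) by omega]
      have h1 := hrow (b + 1 - c.natDegree - k + 1 + p) (by omega) (by omega)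
      rw [Finset.sum_eq_single_of_mem (k - 1 - p) (Finset.mem_range.2 (by omega))] at h1
      · rw [show b + 1 - c.natDegree - k + 1 + p + ((k - 1 - p : ℕ) : ℤ)
          = b + 1 - c.natDegree by omega] at h1
        exact (mul_eq_zero.1 h1).resolve_right (hv (by omega))
      · intro x hx hxp
        rw [Finset.mem_range] at hx
        rcases lt_or_gt_of_ne hxp with h | h
        · rw [hc _ (by omega) (by omega), mul_zero]
        · have := ih (k - 1 - x) (by omega) (by omega)
          rw [show k - 1 - (k - 1 - x) = x by omega] at this
          rw [this, zero_mul]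

theorem degree_div_lt {g c : F[X]} {K : ℕ} (hc : c ≠ 0) (hg : g.degree < K) :
    (g / c).degree < (K - c.natDegree : ℕ) := by
  by_cases h0 : g / c = 0
  · rw [h0, degree_zero]
    exact WithBot.bot_lt_coe _
  have hle : c.degree ≤ g.degree := by
    by_contra h
    exact h0 ((Polynomial.div_eq_zero_iff hc).2 (not_le.1 h))
  have hg0 : g ≠ 0 := by
    rintro rfl
    simp at h0
  rw [← natDegree_lt_iff_degree_lt hg0] at hg
  have h1 := degree_add_div hc hle
  rw [degree_eq_natDegree hc, degree_eq_natDegree h0, degree_eq_natDegree hg0] at h1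
  norm_cast at h1
  rw [← natDegree_lt_iff_degree_lt h0]
  omega

theorem dvd_of_mem_annihilators {s : ℤ → F} {a b : ℤ} {c g : F[X]} {K : ℕ}
    (hc : IsMinimalRecurrence s a b c) (hK : a + K + c.natDegree ≤ b + 2)
    (hg : g ∈ annihilators s a b K) : c ∣ g := by
  have hc0 : c ≠ 0 := fun h => hc.coeff_zero_ne (by simp [h])
  rcases Nat.lt_or_ge c.natDegree K with hKc | hKc
  · have hmod : g % c ∈ annihilators s a (b + c.natDegree - K) c.natDegree := by
      refine ⟨?_, fun t h1 h2 => ?_⟩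
      · rw [← degree_eq_natDegree hc0]
        exact degree_mod_lt _ hc0
      · rw [EuclideanDomain.mod_eq_sub_mul_div, mul_comm]
        have e : shiftAct (g - g / c * c) s t = shiftAct g s t - shiftAct (g / c) (shiftAct c s) t := by
          rw [← shiftAct_mul]
          simp [shiftAct]
        rw [e, hg.2 t h1 (by omega), shiftAct_apply (degree_div_lt hc0 hg.1), zero_sub, neg_eq_zero]
        refine Finset.sum_eq_zero fun p hp => ?_
        rw [Finset.mem_range] at hp
        rw [hc.shiftAct_eq_zero _ (by omega) (by omega), mul_zero]
    rw [hc.annihilators_subsection_eq_bot le_rfl (by omega) (by omega), Submodule.mem_bot] at hmod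
    exact (EuclideanDomain.mod_eq_zero).1 hmod
  · have : g ∈ annihilators s a b c.natDegree :=
      ⟨lt_of_lt_of_le hg.1 (by exact_mod_cast hKc), fun t h1 h2 => hg.2 t h1 (by omega)⟩
    rw [hc.annihilators_eq_bot, Submodule.mem_bot] at this
    simp [this]

/-- Each term by which the section overhangs the range of `c` costs one degree: `u` on the left as a
factor `X ^ u`, `v` on the right as lost leading coefficients. -/
theorem exists_eq_of_mem_annihilators {s : ℤ → F} {a b : ℤ} {c g : F[X]} {u v k : ℕ}
    (hc : IsMinimalRecurrence s a b c)
    (hu : 0 < u → shiftAct c s (a - 1) ≠ 0)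
    (hv : 0 < v → shiftAct c s (b + 1 - c.natDegree) ≠ 0)
    (hk : a + k + c.natDegree ≤ b + 2)
    (hg : g ∈ annihilators s (a - u) (b + v) k) :
    ∃ h : F[X], h.degree < (k - (u + v + c.natDegree) : ℕ) ∧ g = X ^ u * (c * h) := by
  have hc0 : c ≠ 0 := fun h => hc.coeff_zero_ne (by simp [h])
  obtain ⟨h1, h2⟩ := coeff_eq_zero_of_mem_annihilators hc.shiftAct_eq_zero hu hv hk hg
  obtain ⟨g₁, rfl⟩ := X_pow_dvd_iff.2 h1
  by_cases hg0 : g₁ = 0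
  · refine ⟨0, ?_, by simp [hg0]⟩
    rw [degree_zero]
    exact WithBot.bot_lt_coe _
  have hdeg : u + g₁.natDegree + v < k := by
    have h3 := hg.1
    rw [← natDegree_lt_iff_degree_lt (by simp [hg0]), natDegree_X_pow_mul _ hg0] at h3
    by_contra hcon
    have h4 := h2 (k - 1 - (u + g₁.natDegree)) (by omega)
    rw [show k - 1 - (k - 1 - (u + g₁.natDegree)) = g₁.natDegree + u by omega, mul_comm,
      coeff_mul_X_pow, coeff_natDegree, leadingCoeff_eq_zero] at h4
    exact hg0 h4
  have hg₁ : g₁ ∈ annihilators s a b (k - (u + v)) := by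
    refine ⟨(natDegree_lt_iff_degree_lt hg0).1 (by omega), fun t ht1 ht2 => ?_⟩
    have := hg.2 (t - u) (by omega) (by omega)
    rw [shiftAct_X_pow_mul] at this
    simpa using this
  obtain ⟨h, rfl⟩ := dvd_of_mem_annihilators hc (by omega) hg₁
  refine ⟨h, ?_, rfl⟩
  have hh0 : h ≠ 0 := by
    rintro rfl
    simp at hg0
  rw [natDegree_mul hc0 hh0] at hdeg
  exact (natDegree_lt_iff_degree_lt hh0).1 (by omega)

theorem mul_mem_annihilators {s : ℤ → F} {a b : ℤ} {c h : F[X]} {u v k : ℕ} (hc0 : c ≠ 0)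
    (hc : ∀ t : ℤ, a ≤ t → t + c.natDegree ≤ b → shiftAct c s t = 0)
    (hh : h.degree < (k - (u + v + c.natDegree) : ℕ)) :
    X ^ u * (c * h) ∈ annihilators s (a - u) (b + v) k := by
  by_cases hh0 : h = 0
  · simp [hh0]
  have hn := (natDegree_lt_iff_degree_lt hh0).2 hh
  refine X_pow_mul_mem_annihilators (a := a) (b := b) (k := k - (u + v)) ⟨?_, fun t h1 h2 => ?_⟩
    (by omega) (by omega) (by omega)
  · rw [← natDegree_lt_iff_degree_lt (by simp [hc0, hh0]), natDegree_mul hc0 hh0]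
    omega
  · rw [mul_comm, shiftAct_mul, shiftAct_apply hh]
    refine Finset.sum_eq_zero fun p hp => ?_
    rw [Finset.mem_range] at hp
    rw [hc _ (by omega) (by omega), mul_zero]

/-- Every section satisfying a recurrence has one of smallest order; its part with nonzero outer
coefficients holds on a subsection that cannot be enlarged. -/
theorem exists_isMinimalRecurrence {s : ℤ → F} {a b : ℤ} {k : ℕ} (hk : annihilators s a b k ≠ ⊥) :
    ∃ (c : F[X]) (u v : ℕ), IsMinimalRecurrence s (a + u) (b - v) c ∧
      (0 < u → shiftAct c s (a + u - 1) ≠ 0) ∧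
      (0 < v → shiftAct c s (b - v + 1 - c.natDegree) ≠ 0) ∧ u + v + c.natDegree < k := by
  classical
  have hex : ∃ D, annihilators s a b D ≠ ⊥ := ⟨k, hk⟩
  obtain ⟨D, hD, hmin, hDk⟩ : ∃ D, annihilators s a b D ≠ ⊥ ∧
      (∀ D' < D, annihilators s a b D' = ⊥) ∧ D ≤ k :=
    ⟨Nat.find hex, Nat.find_spec hex, fun D' h => not_not.1 (Nat.find_min hex h),
      Nat.find_min' hex hk⟩
  obtain ⟨f, hf, hf0⟩ := (Submodule.ne_bot_iff _).1 hD
  obtain ⟨c, hfc, hcX⟩ := exists_eq_pow_rootMultiplicity_mul_and_not_dvd f hf0 0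
  set u := rootMultiplicity 0 f
  rw [C_0, sub_zero] at hfc hcX
  have hc0 : c ≠ 0 := by
    rintro rfl
    simp at hcX
  have hcoeff : c.coeff 0 ≠ 0 := fun h => hcX (X_dvd_iff.2 h)
  rw [hfc] at hf
  have hdeg : u + c.natDegree < D := by
    have := hf.1
    rwa [← natDegree_lt_iff_degree_lt (by simp [hc0]), natDegree_X_pow_mul _ hc0, add_comm] at this
  have hcdeg : c.degree < (c.natDegree + 1 : ℕ) :=
    (natDegree_lt_iff_degree_lt hc0).1 (Nat.lt_succ_self _)
  have hrec : ∀ t : ℤ, a + u ≤ t → t + c.natDegree ≤ b - (D - 1 - u - c.natDegree : ℕ) →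
      shiftAct c s t = 0 := by
    intro t h1 h2
    have := hf.2 (t - u) (by omega) (by omega)
    rw [shiftAct_X_pow_mul] at this
    simpa using this
  have hnot : ∀ g : F[X], g ≠ 0 → g ∉ annihilators s a b (D - 1) := by
    intro g hg h
    rw [hmin _ (by omega), Submodule.mem_bot] at h
    exact hg h
  refine ⟨c, u, D - 1 - u - c.natDegree, ⟨hcoeff, hrec, ?_⟩, fun hu h => ?_, fun hv h => ?_,
    by omega⟩
  · refine (Submodule.eq_bot_iff _).2 fun g hg => by_contra fun hg0 => ?_
    exact hnot (X ^ u * g) (by simp [hg0])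
      (X_pow_mul_mem_annihilators hg (by omega) (by omega) (by omega))
  -- If `c` held one place further, on either side, there would be a nonzero annihilator for `D -
  -- 1`, against the choice of `D`.
  · refine hnot (X ^ (u - 1) * c) (by simp [hc0]) ⟨degree_X_pow_mul_lt hcdeg (by omega), ?_⟩
    intro t h1 h2
    rw [shiftAct_X_pow_mul]
    by_cases ht : t = a
    · rwa [ht, show a + ((u - 1 : ℕ) : ℤ) = a + u - 1 by omega]
    · exact hrec _ (by omega) (by omega)
  · refine hnot (X ^ u * c) (by simp [hc0]) ⟨degree_X_pow_mul_lt hcdeg (by omega), ?_⟩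
    intro t h1 h2
    rw [shiftAct_X_pow_mul]
    by_cases ht : t + u = b - (D - 1 - u - c.natDegree : ℕ) + 1 - c.natDegree
    · rwa [ht]
    · exact hrec _ (by omega) (by omega)

/-! ### From a recurrence to a window -/

theorem exists_maximal_left_extension {Z : ℤ → Prop} {a b : ℤ} (ha : 1 ≤ a)
    (hZ : ∀ t, a ≤ t → t ≤ b → Z t) :
    ∃ a', 1 ≤ a' ∧ a' ≤ a ∧ (∀ t, a' ≤ t → t ≤ b → Z t) ∧ (1 < a' → ¬ Z (a' - 1)) := by
  obtain ⟨a', ⟨h1, h2, h3⟩, hmin⟩ := Int.exists_least_of_bdd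
    (P := fun z => 1 ≤ z ∧ z ≤ a ∧ ∀ t, z ≤ t → t ≤ b → Z t) ⟨1, fun z hz => hz.1⟩
    ⟨a, ha, le_rfl, hZ⟩
  refine ⟨a', h1, h2, h3, fun h hZ' => ?_⟩
  have := hmin (a' - 1) ⟨by omega, by omega, fun t ht1 ht2 => ?_⟩
  · omega
  · by_cases ht : t = a' - 1
    · rwa [ht]
    · exact h3 t (by omega) ht2

theorem exists_maximal_right_extension {Z : ℤ → Prop} {a b R : ℤ} (hb : b ≤ R)
    (hZ : ∀ t, a ≤ t → t ≤ b → Z t) :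
    ∃ b', b ≤ b' ∧ b' ≤ R ∧ (∀ t, a ≤ t → t ≤ b' → Z t) ∧ (b' < R → ¬ Z (b' + 1)) := by
  obtain ⟨b', ⟨h1, h2, h3⟩, hmax⟩ := Int.exists_greatest_of_bdd
    (P := fun z => b ≤ z ∧ z ≤ R ∧ ∀ t, a ≤ t → t ≤ z → Z t) ⟨R, fun z hz => hz.2.1⟩
    ⟨b, le_rfl, hb, hZ⟩
  refine ⟨b', h1, h2, h3, fun h hZ' => ?_⟩
  have := hmax (b' + 1) ⟨by omega, by omega, fun t ht1 ht2 => ?_⟩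
  · omega
  · by_cases ht : t = b' + 1
    · rwa [ht]
    · exact h3 t ht1 (by omega)

theorem numberWall_eq_zero_of_mem {S : ℤ → F} {a b : ℤ} {c : F[X]} (hc0 : c ≠ 0)
    (hc : ∀ t : ℤ, a ≤ t → t + c.natDegree ≤ b → shiftAct c S t = 0) {i : ℕ} {j : ℤ}
    (hi : c.natDegree ≤ i) (hi' : i + a + c.natDegree ≤ b)
    (hj : a + c.natDegree ≤ j) (hj' : j + c.natDegree ≤ b) : numberWall S i j = 0 := by
  rw [numberWall_eq_zero_iff, Submodule.ne_bot_iff]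
  obtain ⟨x, hx⟩ : ∃ x, x = max a (j - i) := ⟨_, rfl⟩
  obtain ⟨y, hy⟩ : ∃ y, y = min b (j + i) := ⟨_, rfl⟩
  have h1 := mul_mem_annihilators (s := S) (a := x) (b := y) (c := c) (h := 1)
    (u := (x - (j - i)).toNat) (v := (j + i - y).toNat) (k := i + 1) hc0
    (fun t h1 h2 => hc t (by omega) (by omega)) (by
      rw [degree_one]
      have : 0 < i + 1 - ((x - (j - i)).toNat + (j + i - y).toNat + c.natDegree) := by omega
      exact_mod_cast this)
  refine ⟨_, annihilators_mono (by omega) (by omega) h1, by simp [hc0]⟩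

theorem numberWall_ne_zero_of_frame {S : ℤ → F} {a b r : ℤ} {c : F[X]}
    (hc : IsMinimalRecurrence S a b c) (hlen : a + 2 * c.natDegree ≤ b)
    (ha : 1 < a → shiftAct c S (a - 1) ≠ 0)
    (hb : b < r → shiftAct c S (b + 1 - c.natDegree) ≠ 0) {i : ℕ} {j : ℤ}
    (hij : 1 ≤ j - i) (hij' : j + i ≤ r)
    (hi : (c.natDegree : ℤ) - 1 ≤ i) (hi' : i + a + c.natDegree ≤ b + 1)
    (hj : a + c.natDegree - 1 ≤ j) (hj' : j + c.natDegree ≤ b + 1)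
    (hframe : (i : ℤ) = c.natDegree - 1 ∨ i + a + c.natDegree = b + 1 ∨
      j = a + c.natDegree - 1 ∨ j + c.natDegree = b + 1) : numberWall S i j ≠ 0 := by
  rw [Ne, numberWall_eq_zero_iff, not_not, Submodule.eq_bot_iff]
  intro g hg
  obtain ⟨x, hx⟩ : ∃ x, x = max a (j - i) := ⟨_, rfl⟩
  obtain ⟨y, hy⟩ : ∃ y, y = min b (j + i) := ⟨_, rfl⟩
  obtain ⟨u, hu⟩ : ∃ u : ℕ, x - u = j - i := ⟨(x - (j - i)).toNat, by omega⟩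
  obtain ⟨v, hv⟩ : ∃ v : ℕ, y + v = j + i := ⟨(j + i - y).toNat, by omega⟩
  -- On the frame the overhang and the degree of `c` use up all `i + 1` available coefficients, so
  -- the cofactor `h` must vanish.
  have huv : u + v + c.natDegree = i + 1 := by omega
  rw [← hu, ← hv] at hg
  obtain ⟨h, hh, rfl⟩ := exists_eq_of_mem_annihilators
    (hc.subsection (by omega) (by omega) (by omega))
    (fun h => by rw [show x = a by omega]; exact ha (by omega))
    (fun h => by rw [show y = b by omega]; exact hb (by omega)) (by push_cast; omega) hg
  rw [huv, Nat.sub_self] at hh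
  have : h = 0 := by simpa using hh
  simp [this]

theorem exists_isWindow_of_annihilators_ne_bot {r l m : ℕ} (hl : 1 ≤ l) {s : Fin r → F} {a : ℤ}
    (ha : 1 ≤ a) (hb : a + 2 * m + l - 1 ≤ r)
    (hann : annihilators (extendSeq s) a (a + 2 * m + l - 1) (m + 1) ≠ ⊥) :
    ∃ B : SquarePortion, IsWindow s B ∧ B.Contains ⟨l, a + m, m⟩ := by
  obtain ⟨c, u, v, hc, -, -, huv⟩ := exists_isMinimalRecurrence hann
  have hc0 : c ≠ 0 := fun h => hc.coeff_zero_ne (by simp [h])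
  -- The extension stays within the indices `1, …, r`, so the continuation by zero plays no role.
  obtain ⟨a', ha1, ha2, hca, hamax⟩ := exists_maximal_left_extension
    (Z := fun t => shiftAct c (extendSeq s) t = 0) (a := a + u)
    (b := a + 2 * m + l - 1 - v - c.natDegree) (by omega)
    (fun t h1 h2 => hc.shiftAct_eq_zero t h1 (by omega))
  obtain ⟨b'', hb1, hb2, hcb, hbmax⟩ := exists_maximal_right_extension (R := r - c.natDegree)
    (by omega) hca
  obtain ⟨b', rfl⟩ : ∃ b', b'' = b' - c.natDegree := ⟨b'' + c.natDegree, by omega⟩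
  have hmin : IsMinimalRecurrence (extendSeq s) a' b' c :=
    ⟨hc.coeff_zero_ne, fun t h1 h2 => hcb t h1 (by omega), by
      rw [eq_bot_iff, ← hc.annihilators_eq_bot]
      exact annihilators_mono (by omega) (by omega)⟩
  obtain ⟨L, hL⟩ : ∃ L : ℕ, (L : ℤ) = b' - a' + 1 - 2 * c.natDegree :=
    ⟨(b' - a' + 1 - 2 * c.natDegree).toNat, by omega⟩
  refine ⟨⟨L, a' + c.natDegree, c.natDegree⟩, ⟨?_, ⟨?_, ?_⟩, ?_, ?_⟩, ?_⟩
  · show 1 ≤ L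
    omega
  · show (0 : ℤ) ≤ c.natDegree
    omega
  · intro j h1 h2
    simp only at h1 h2
    simp only [InFiniteWall]
    omega
  · intro i j hij hmem
    simp only [SquarePortion.Mem] at hmem
    lift i to ℕ using by omega
    exact numberWall_eq_zero_of_mem hc0 hmin.shiftAct_eq_zero (by omega) (by omega) (by omega)
      (by omega)
  · intro i j hij hframe
    simp only [SquarePortion.InnerFrame, SquarePortion.Mem, not_and_or, not_le, not_lt] at hframe
    obtain ⟨h1, h2⟩ := hij
    by_cases hi : i < 0
    · rw [show i = -1 by omega]
      simp [numberWall]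
    lift i to ℕ using by omega
    refine numberWall_ne_zero_of_frame hmin (r := r) (by omega) hamax (fun h => ?_) h1 h2
      (by omega) (by omega) (by omega) (by omega) (by omega)
    rw [show b' + 1 - (c.natDegree : ℤ) = b' - c.natDegree + 1 by omega]
    exact hbmax (by omega)
  · simp only [SquarePortion.Contains]
    omega

/-! ### From a window to a recurrence -/

/-- The nonzero entry above makes annihilators of the last `2k` terms determined by their constant
coefficient. Hence `c` is a multiple of the polynomial `d` supplied by the zero entry, and `d` also
covers the new term. -/
theorem mem_annihilators_succ_of_numberWall {S : ℤ → F} {k : ℕ} {a b : ℤ} {c : F[X]}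
    (hab : a + 2 * k ≤ b) (hc : c ∈ annihilators S a b (k + 1))
    (hz : numberWall S k (b + 1 - k) = 0) (hnz : numberWall S (k - 1) (b + 1 - k) ≠ 0) :
    c ∈ annihilators S a (b + 1) (k + 1) := by
  have hbot : annihilators S (b + 2 - 2 * k) b k = ⊥ := by
    rcases k with _ | k
    · exact annihilators_zero _ _ _
    · rw [show ((k + 1 : ℕ) : ℤ) - 1 = (k : ℕ) by omega, Ne, numberWall_eq_zero_iff, not_not] at hnz
      rw [← hnz]
      congr 1 <;> push_cast <;> omega
  have hX : ∀ g ∈ annihilators S (b + 1 - 2 * k) b (k + 1), g.coeff 0 = 0 → g = 0 := by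
    intro g hg h0
    obtain ⟨g, rfl⟩ := X_dvd_iff.2 h0
    rw [← pow_one (X : F[X]), add_comm k 1] at hg
    have : g ∈ annihilators S (b + 2 - 2 * k) b k :=
      annihilators_mono (by push_cast; omega) le_rfl (X_pow_mul_mem_annihilators_iff.1 hg)
    rw [hbot, Submodule.mem_bot] at this
    simp [this]
  rw [numberWall_eq_zero_iff, Submodule.ne_bot_iff] at hz
  obtain ⟨d, hd, hd0⟩ := hz
  replace hd : d ∈ annihilators S (b + 1 - 2 * k) (b + 1) (k + 1) :=
    annihilators_mono (by omega) (by omega) hd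
  have hd' : d ∈ annihilators S (b + 1 - 2 * k) b (k + 1) :=
    annihilators_mono le_rfl (by omega) hd
  have hdc : d.coeff 0 ≠ 0 := fun h => hd0 (hX d hd' h)
  have hc' : c ∈ annihilators S (b + 1 - 2 * k) b (k + 1) :=
    annihilators_mono (by omega) le_rfl hc
  have hcd : c = (c.coeff 0 / d.coeff 0) • d := by
    have := hX _ (Submodule.sub_mem _ hc' (Submodule.smul_mem _ (c.coeff 0 / d.coeff 0) hd'))
      (by simp [hdc])
    exact sub_eq_zero.1 this
  refine ⟨hc.1, fun t h1 h2 => ?_⟩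
  by_cases ht : t + (k + 1 : ℕ) ≤ b + 1
  · exact hc.2 t h1 ht
  · have hcmem : c ∈ annihilators S (b + 1 - 2 * k) (b + 1) (k + 1) := by
      rw [hcd]
      exact Submodule.smul_mem _ _ hd
    exact hcmem.2 t (by push_cast at ht; omega) h2

theorem annihilators_ne_bot_of_isWindow {r l m : ℕ} {s : Fin r → F} {a : ℤ} {B : SquarePortion}
    (hB : IsWindow s B) (hcon : B.Contains ⟨l, a + m, m⟩) :
    annihilators (extendSeq s) a (a + 2 * m + l - 1) (m + 1) ≠ ⊥ := by
  obtain ⟨L, y, k⟩ := B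
  obtain ⟨hL, ⟨hk, htop⟩, hzero, hframe⟩ := hB
  simp only [SquarePortion.Contains, SquarePortion.Mem, SquarePortion.InnerFrame] at *
  lift k to ℕ using hk
  have hz : ∀ j, y ≤ j → j < y + L → numberWall (extendSeq s) k j = 0 := fun j h1 h2 =>
    hzero k j (htop j h1 h2) (by omega)
  have hnz : ∀ j, y ≤ j → j < y + L → numberWall (extendSeq s) (k - 1) j ≠ 0 := by
    intro j h1 h2
    have := htop j h1 h2
    simp only [InFiniteWall] at this
    exact hframe _ j (by simp only [InFiniteWall]; omega) (by omega)
  obtain ⟨c, hc, hc0⟩ := (Submodule.ne_bot_iff _).1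
    ((numberWall_eq_zero_iff _ _ _).1 (hz y le_rfl (by omega)))
  have hall : ∀ x : ℕ, x < L → c ∈ annihilators (extendSeq s) (y - k) (y + k + x) (k + 1) := by
    intro x
    induction x with
    | zero => intro _; simpa using hc
    | succ x ih =>
      intro hx
      have := mem_annihilators_succ_of_numberWall (by omega) (ih (by omega))
        (hz _ (by omega) (by omega)) (hnz _ (by omega) (by omega))
      simpa [add_assoc] using this
  rw [Submodule.ne_bot_iff]
  -- The power of `X` skips the terms before the window's own section; `toNat` gives exponent `0` if
  -- there are none.
  refine ⟨X ^ (y - k - a).toNat * c, X_pow_mul_mem_annihilators (hall (L - 1) (by omega))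
    (by omega) (by omega) ?_, by simp [hc0]⟩
  push_cast
  omega

/-! ### Counting -/

theorem natCard_degreeLT [Finite F] (k : ℕ) : Nat.card (degreeLT F k) = Nat.card F ^ k := by
  rw [Nat.card_congr (degreeLTEquiv F k).toEquiv, Nat.card_fun, Nat.card_fin]

instance finite_degreeLT [Finite F] (k : ℕ) : Finite (degreeLT F k) :=
  Finite.of_equiv _ (degreeLTEquiv F k).symm.toEquiv

theorem annihilators_le_degreeLT (s : ℤ → F) (a b : ℤ) (k : ℕ) :
    annihilators s a b k ≤ degreeLT F k := fun _ hg => mem_degreeLT.2 hg.1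

instance finite_annihilators [Finite F] (s : ℤ → F) (a b : ℤ) (k : ℕ) :
    Finite (annihilators s a b k) :=
  Finite.of_injective _ (Submodule.inclusion_injective (annihilators_le_degreeLT s a b k))

theorem natCard_annihilators {s : ℤ → F} {a b : ℤ} {c : F[X]} {u v k : ℕ} [Finite F]
    (hc : IsMinimalRecurrence s a b c)
    (hu : 0 < u → shiftAct c s (a - 1) ≠ 0)
    (hv : 0 < v → shiftAct c s (b + 1 - c.natDegree) ≠ 0)
    (hk : a + k + c.natDegree ≤ b + 2) :
    Nat.card (annihilators s (a - u) (b + v) k) = Nat.card F ^ (k - (u + v + c.natDegree)) := by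
  have hc0 : c ≠ 0 := fun h => hc.coeff_zero_ne (by simp [h])
  rw [← natCard_degreeLT]
  refine (Nat.card_congr (Equiv.ofBijective (fun h : degreeLT F (k - (u + v + c.natDegree)) =>
    (⟨X ^ u * (c * h.1), mul_mem_annihilators hc0 hc.shiftAct_eq_zero (mem_degreeLT.1 h.2)⟩ :
      annihilators s (a - u) (b + v) k)) ⟨?_, ?_⟩)).symm
  · intro g h hgh
    have := congrArg Subtype.val hgh
    exact Subtype.ext (mul_left_cancel₀ hc0 (mul_left_cancel₀ (pow_ne_zero u X_ne_zero) this))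
  · rintro ⟨g, hg⟩
    obtain ⟨h, hh, rfl⟩ := exists_eq_of_mem_annihilators hc hu hv hk hg
    exact ⟨⟨h, mem_degreeLT.2 hh⟩, rfl⟩

/-- The same `c`, `u`, `v` describe the annihilators for `m` and `m + 1`; the cofactor gains one
free coefficient. -/
theorem natCard_annihilators_succ [Finite F] {s : ℤ → F} {a b : ℤ} {m : ℕ} (hab : a + 2 * m ≤ b)
    (hne : annihilators s a b (m + 1) ≠ ⊥) :
    Nat.card (annihilators s a b (m + 1)) = Nat.card F * Nat.card (annihilators s a b m) := by
  obtain ⟨c, u, v, hc, hu, hv, huv⟩ := exists_isMinimalRecurrence hne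
  have h1 := natCard_annihilators (k := m + 1) hc hu hv (by push_cast; omega)
  have h2 := natCard_annihilators (k := m) hc hu hv (by omega)
  rw [add_sub_cancel_right, sub_add_cancel] at h1 h2
  rw [h1, h2, ← pow_succ']
  congr 1
  omega

theorem annihilators_eq_bot_of_succ {s : ℤ → F} {a b : ℤ} {m : ℕ}
    (h : annihilators s a b (m + 1) = ⊥) : annihilators s a b m = ⊥ := by
  refine (Submodule.eq_bot_iff _).2 fun g hg => ?_
  have h1 : X ^ 1 * g ∈ annihilators s a b (m + 1) :=
    X_pow_mul_mem_annihilators hg (by omega) (by omega) (by push_cast; omega)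
  rw [h, Submodule.mem_bot] at h1
  simpa using h1

/-- Continuation by zero as a linear map. -/
noncomputable def extendSeqHom (F : Type*) [Field F] (r : ℕ) : (Fin r → F) →ₗ[F] (ℤ → F) where
  toFun s := extendSeq s
  map_add' s s' := by
    ext t
    simp only [extendSeq, Pi.add_apply]
    split_ifs <;> simp
  map_smul' x s := by
    ext t
    simp only [extendSeq, Pi.smul_apply, RingHom.id_apply]
    split_ifs <;> simp

/-- The linear map sending a finite sequence to a section of length `N` of the image of its
continuation under a polynomial. -/
noncomputable def shiftActSection (g : F[X]) (a : ℤ) (r N : ℕ) : (Fin r → F) →ₗ[F] (Fin N → F) :=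
  LinearMap.funLeft F F (fun x : Fin N => a + (x : ℤ)) ∘ₗ aeval (seqShift F) g ∘ₗ extendSeqHom F r

theorem shiftActSection_apply (g : F[X]) (a : ℤ) {r N : ℕ} (s : Fin r → F) (x : Fin N) :
    shiftActSection g a r N s x = shiftAct g (extendSeq s) (a + x) := rfl

theorem shiftActSection_surjective {g : F[X]} {a : ℤ} {r N : ℕ} (hg : g ≠ 0) (ha : 1 ≤ a)
    (hN : a + g.natDegree + N ≤ r + 1) : Function.Surjective (shiftActSection g a r N) := by
  -- Restricted to sequences supported on the `N` places from `a + g.natDegree` on, the map is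
  -- triangular with the leading coefficient of `g` on the diagonal.
  let ψ : (Fin N → F) →ₗ[F] (Fin r → F) :=
    LinearMap.funLeft F F (fun i : Fin r => (i : ℤ) + 2 - a - g.natDegree) ∘ₗ extendSeqHom F N
  have hψ : ∀ y : Fin N → F, ∀ t : ℤ,
      extendSeq (ψ y) t = extendSeq y (t + 1 - a - g.natDegree) := by
    intro y t
    by_cases ht : 1 ≤ t ∧ t ≤ r
    · have : extendSeq (ψ y) t
          = extendSeq y ((((t - 1).toNat : ℕ) : ℤ) + 2 - a - g.natDegree) := by
        conv_lhs => rw [extendSeq, dif_pos ht]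
        rfl
      rw [this]
      congr 1
      omega
    · conv_lhs => rw [extendSeq, dif_neg ht]
      rw [extendSeq, dif_neg]
      omega
  have hinj : Function.Injective (shiftActSection g a r N ∘ₗ ψ) := by
    rw [← LinearMap.ker_eq_bot, LinearMap.ker_eq_bot']
    intro y hy
    have hval : ∀ x : ℕ, (hx : x < N) → y ⟨x, hx⟩ = 0 := by
      intro x
      induction x using Nat.strong_induction_on with
      | _ x ih =>
        intro hx
        have h1 : shiftAct g (extendSeq (ψ y)) (a + x) = 0 := congrFun hy ⟨x, hx⟩
        rw [shiftAct_apply ((natDegree_lt_iff_degree_lt hg).1 (Nat.lt_succ_self _)),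
          Finset.sum_range_succ, Finset.sum_eq_zero, zero_add] at h1
        · have h2 := (mul_eq_zero.1 h1).resolve_left (by simpa using hg)
          rw [hψ, extendSeq, dif_pos (by omega)] at h2
          rw [← h2]
          congr 2
          omega
        · intro p hp
          rw [Finset.mem_range] at hp
          rw [hψ, extendSeq]
          split_ifs with h
          · rw [ih _ (by omega), mul_zero]
          · rw [mul_zero]
    ext x
    exact hval x x.2
  have hsurj := LinearMap.injective_iff_surjective.1 hinj
  exact Function.Surjective.of_comp (g := ψ) hsurj

theorem natCard_annihilated [Finite F] {g : F[X]} {a b : ℤ} {r k N : ℕ} (hg : g ≠ 0)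
    (hgk : g.degree < k) (ha : 1 ≤ a) (hb : b ≤ r) (hN : a + k + N = b + 2) :
    Nat.card {s : Fin r → F // g ∈ annihilators (extendSeq s) a b k} = Nat.card F ^ (r - N) := by
  have hn := (natDegree_lt_iff_degree_lt hg).2 hgk
  have hsurj := shiftActSection_surjective (r := r) (N := N) hg ha (by omega)
  have h1 := LinearMap.finrank_range_add_finrank_ker (shiftActSection g a r N)
  rw [LinearMap.range_eq_top.2 hsurj, finrank_top, Module.finrank_fin_fun,
    Module.finrank_fin_fun] at h1
  rw [show r - N = Module.finrank F (LinearMap.ker (shiftActSection g a r N)) by omega,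
    ← Module.natCard_eq_pow_finrank]
  refine Nat.card_congr (Equiv.subtypeEquivRight fun s => ?_)
  rw [LinearMap.mem_ker, mem_annihilators]
  constructor
  · rintro ⟨-, h⟩
    ext x
    exact h (a + (x : ℕ)) (by omega) (by omega)
  · refine fun h => ⟨hgk, fun t h1 h2 => ?_⟩
    have := congrFun h ⟨(t - a).toNat, by omega⟩
    rw [shiftActSection_apply] at this
    rwa [show a + (((t - a).toNat : ℕ) : ℤ) = t by omega] at this

/-- Count pairs of a sequence and an annihilator by the annihilator: zero allows every sequence, any
other polynomial imposes `N` independent equations. -/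
theorem sum_natCard_annihilators [Fintype F] {a b : ℤ} {r k N : ℕ} (ha : 1 ≤ a) (hb : b ≤ r)
    (hN : a + k + N = b + 2) :
    ∑ s : Fin r → F, Nat.card (annihilators (extendSeq s) a b k)
      = Nat.card F ^ r + (Nat.card F ^ k - 1) * Nat.card F ^ (r - N) := by
  classical
  let e : (Σ s : Fin r → F, annihilators (extendSeq s) a b k) ≃
      Σ g : degreeLT F k, {s : Fin r → F // g.1 ∈ annihilators (extendSeq s) a b k} :=
    { toFun := fun x => ⟨⟨x.2.1, mem_degreeLT.2 x.2.2.1⟩, ⟨x.1, x.2.2⟩⟩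
      invFun := fun x => ⟨x.2.1, ⟨x.1.1, x.2.2⟩⟩
      left_inv := fun _ => rfl
      right_inv := fun _ => rfl }
  let _ : Fintype (degreeLT F k) := Fintype.ofFinite _
  have h := Nat.card_congr e
  rw [Nat.card_sigma, Nat.card_sigma] at h
  rw [h, ← Finset.add_sum_erase _ _ (Finset.mem_univ 0)]
  congr 1
  · rw [Nat.card_congr (Equiv.subtypeUnivEquiv
      (p := fun s : Fin r → F => (0 : degreeLT F k).1 ∈ annihilators (extendSeq s) a b k)
      fun s => Submodule.zero_mem _), Nat.card_fun, Nat.card_fin]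
  · rw [Finset.sum_congr rfl (g := fun _ => Nat.card F ^ (r - N)), Finset.sum_const,
      Finset.card_erase_of_mem (Finset.mem_univ _), Finset.card_univ, ← Nat.card_eq_fintype_card,
      natCard_degreeLT, smul_eq_mul]
    intro g hg
    exact natCard_annihilated (fun h => Finset.ne_of_mem_erase hg (Subtype.ext h))
      (mem_degreeLT.1 g.2) ha hb hN

theorem natCard_annihilators_ne_bot [Fintype F] {a b : ℤ} {r l m : ℕ} (ha : 1 ≤ a) (hb : b ≤ r)
    (hl : 1 ≤ l) (hab : b = a + 2 * m + l - 1) :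
    Nat.card {s : Fin r → F // annihilators (extendSeq s) a b (m + 1) ≠ ⊥}
      = Nat.card F ^ (r - l) := by
  classical
  set q := Nat.card F with hq
  have hq1 : 1 < q := Finite.one_lt_card
  have hpoint : ∀ s : Fin r → F, Nat.card (annihilators (extendSeq s) a b (m + 1)) + (q - 1)
      = q * Nat.card (annihilators (extendSeq s) a b m)
        + if annihilators (extendSeq s) a b (m + 1) ≠ ⊥ then q - 1 else 0 := by
    intro s
    split_ifs with h
    · rw [natCard_annihilators_succ (by omega) h]
    · rw [not_not] at h
      rw [annihilators_eq_bot_of_succ h, h]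
      simp
      omega
  have hsum := Finset.sum_congr (rfl : (Finset.univ : Finset (Fin r → F)) = _)
    fun s _ => hpoint s
  rw [Finset.sum_add_distrib, Finset.sum_add_distrib, ← Finset.mul_sum, ← Finset.sum_filter,
    Finset.sum_const, Finset.sum_const, ← Fintype.card_subtype, ← Nat.card_eq_fintype_card,
    sum_natCard_annihilators (N := m + l) ha hb (by push_cast; omega),
    sum_natCard_annihilators (N := m + l + 1) ha hb (by push_cast; omega), Finset.card_univ,
    ← Nat.card_eq_fintype_card, Nat.card_fun, Nat.card_fin, ← hq] at hsum
  set A := Nat.card {s : Fin r → F // annihilators (extendSeq s) a b (m + 1) ≠ ⊥}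
  obtain ⟨E, hE⟩ : ∃ E, r = E + 2 * m + l := ⟨r - 2 * m - l, by omega⟩
  -- For `m = 0` the exponent `r - (m + l + 1)` may be truncated, but then the factor `q ^ m - 1` is
  -- zero.
  have hpow : q * ((q ^ m - 1) * q ^ (r - (m + l + 1))) = (q ^ m - 1) * q ^ (E + m) := by
    rcases Nat.eq_zero_or_pos m with rfl | hm
    · simp
    · rw [show E + m = r - (m + l + 1) + 1 by omega, pow_succ]
      ring
  rw [mul_add, hpow, show r - (m + l) = E + m by omega, smul_eq_mul, smul_eq_mul] at hsum
  rw [show r - l = E + 2 * m by omega]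
  have h1 : 1 ≤ q ^ m := Nat.one_le_pow _ _ (by omega)
  have h2 : 1 ≤ q ^ (m + 1) := Nat.one_le_pow _ _ (by omega)
  zify [h1, h2, hq1.le] at hsum ⊢
  have hq0 : (q : ℤ) - 1 ≠ 0 := by omega
  apply mul_right_cancel₀ hq0
  have e1 : (q : ℤ) ^ (E + 2 * m) = q ^ (E + m) * q ^ m := by ring
  rw [e1]
  rw [pow_succ (q : ℤ) m] at hsum
  linear_combination -hsum

end NumberWallWindows

theorem mainTheorem7 {F : Type*} [Field F] [Fintype F] (q : ℕ) (hq : Fintype.card F = q)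
    (r l n m : ℕ) (hl : 1 ≤ l) (hr : 2 * m + 1 + l ≤ r)
    (hB : SquarePortion.TopRowInWall r ⟨l, (n : ℤ), (m : ℤ)⟩) :
    Nat.card {s : Fin r → F // ∃ B : SquarePortion,
      IsWindow s B ∧ B.Contains ⟨l, (n : ℤ), (m : ℤ)⟩} = q ^ (r - l) := by
  have h1 := hB.2 n le_rfl (by simp only; omega)
  have h2 := hB.2 (n + l - 1) (by simp only; omega) (by simp only; omega)
  simp only [InFiniteWall] at h1 h2
  rw [← hq, ← Nat.card_eq_fintype_card,
    ← natCard_annihilators_ne_bot (a := n - m) (b := n - m + 2 * m + l - 1) (r := r) (m := m)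
      (by omega) (by omega) hl rfl]
  refine Nat.card_congr (Equiv.subtypeEquivRight fun s => ⟨?_, fun h => ?_⟩)
  · rintro ⟨B, hwin, hcon⟩
    exact annihilators_ne_bot_of_isWindow hwin (by rwa [sub_add_cancel])
  · simpa using exists_isWindow_of_annihilators_ne_bot hl (by omega) (by omega) h
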